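/- For a finite simple graph $G$ and a graph $H$, let $N(H,G)$ denote the number of copies of $H$ in $G$, i.e. of (not necessarily induced) subgraphs of $G$ isomorphic to $H$. For integers $n\ge 1$ and $0\le e\le\binom n2$ let $$ex(n,e,H)=\max\{N(H,G): |V(G)|=n,\ |E(G)|=e\}.$$ Write $e=\binom a2+b$ with $0\le b<a$ (this is possible in exactly one way). The quasi-clique $K_n^e$ is the graph with $n$ vertices and $e$ edges that consists of a clique on $a$ vertices, one further vertex joined to exactly $b$ vertices of the clique (no such vertex is needed when $b=0$), and isolated vertices otherwise. **Theorem.** For every finite graph $H$ there is a constant $c_H$ with $0<c_H<1$ such that $$ex(n,e,H)=(1+o(1))\,N(H,K_n^e)\qquad\text{for } c_H\binom n2\le e\le\binom n2,$$ where $o(1)$ tends to $0$ as $n\to\infty$, uniformly in $e$. That is, for every $\varepsilon>0$ there is an $n_0$ such that for all $n\ge n_0$ and all integers $e$ with $c_H\binom n2\le e\le\binom n2$, $$\bigl|ex(n,e,H)-N(H,K_n^e)\bigr|\le\varepsilon\,N(H,K_n^e).$$ -/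

import Mathlib

/-- `ex(n, e, H)`: the maximum number of copies of `H` (subgraphs isomorphic to `H`, not necessarily
induced) in a graph with `n` vertices and exactly `e` edges. There is such a graph if and only if
`e ≤ n.choose 2`; the value is `0` otherwise. -/
noncomputable def maxCopies {V : Type*} (n e : ℕ) (H : SimpleGraph V) : ℕ :=
  open scoped Classical in
  ((Finset.univ : Finset (SimpleGraph (Fin n))).filter fun G => G.edgeSet.ncard = e).sup
    fun G => G.copyCount H

/-- The largest `a` with `a.choose 2 ≤ e`; see `cliqueSize_eq`. -/
def cliqueSize (e : ℕ) : ℕ := Nat.findGreatest (fun a => a.choose 2 ≤ e) (e + 1)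

/-- Every `e` is written as `a.choose 2 + b` with `0 ≤ b < a` for `a = cliqueSize e` ... -/
theorem cliqueSize_spec (e : ℕ) :
    ∃ b, b < cliqueSize e ∧ e = (cliqueSize e).choose 2 + b := by
  have h1 : (cliqueSize e).choose 2 ≤ e :=
    Nat.findGreatest_spec (P := fun a => a.choose 2 ≤ e) (m := 0) (Nat.zero_le _) (by simp)
  refine ⟨e - (cliqueSize e).choose 2, ?_, by omega⟩
  by_contra h2
  have h3 : (cliqueSize e + 1).choose 2 = cliqueSize e + (cliqueSize e).choose 2 := by
    rw [Nat.choose_succ_succ' _ 1, Nat.choose_one_right]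
  have h4 : cliqueSize e + 1 ≤ cliqueSize e := by
    refine Nat.le_findGreatest (P := fun a => a.choose 2 ≤ e) ?_ ?_
    · omega
    · show (cliqueSize e + 1).choose 2 ≤ e
      omega
  omega

/-- ... and in no other way. -/
theorem cliqueSize_eq {a b : ℕ} (h : b < a) : cliqueSize (a.choose 2 + b) = a := by
  obtain ⟨b', hb, he⟩ := cliqueSize_spec (a.choose 2 + b)
  set c := cliqueSize (a.choose 2 + b)
  have hs (m : ℕ) : (m + 1).choose 2 = m + m.choose 2 := by
    rw [Nat.choose_succ_succ' _ 1, Nat.choose_one_right]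
  rcases lt_trichotomy c a with hc | hc | hc
  · have := Nat.choose_le_choose 2 (Nat.succ_le_of_lt hc)
    have := hs c
    simp only [Nat.succ_eq_add_one] at *
    omega
  · exact hc
  · have := Nat.choose_le_choose 2 (Nat.succ_le_of_lt hc)
    have := hs a
    simp only [Nat.succ_eq_add_one] at *
    omega

/-- The quasi-clique with `n` vertices and `e` edges. Write `e = a.choose 2 + b` with `0 ≤ b < a`:
the vertices `0, ..., a - 1` form a clique, the vertex `a` (present when `a < n`) is adjacent exactly
to `0, ..., b - 1`, and all other vertices are isolated. -/
def quasiClique (n e : ℕ) : SimpleGraph (Fin n) where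
  Adj u v := u ≠ v ∧
    ((max u v : ℕ) < cliqueSize e ∨
      (max u v : ℕ) = cliqueSize e ∧ (min u v : ℕ) < e - (cliqueSize e).choose 2)
  symm := ⟨fun u v h => by rwa [ne_comm, max_comm (v : ℕ), min_comm (v : ℕ)]⟩
  loopless := ⟨fun _ h => h.1 rfl⟩

/-! The trivial lower bound is that the quasi-clique competes for the maximum. For the upper bound,
every `H` has a spanning star forest with the same isolated vertices, and forgetting injectivity and
all other edges bounds the labelled copies of `H` by a product of star sums `∑ d(x) ^ s` and factors
`n` for isolated vertices. If `e` is close to `n.choose 2`, then `∑ d(x) ^ s ≤ √(2e) ^ (s + 1)`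
(`SimpleGraph.sum_degree_pow_le`). So each non-isolated vertex of `H` costs a factor `√(2e) ≤ a +
1`, where `a` is the clique size. Placing these vertices in the clique and the others anywhere shows
that the quasi-clique attains this product up to a factor `1 + o(1)`. Dividing by the number of
automorphisms passes to unlabelled copies. The star inequality is the only place that needs high
density: cutting off the few vertices of low degree leaves a near-clique, whose degrees are expanded
to second order and compared with the tangent of `p ↦ p ^ ((s + 1) / 2)`. -/

open Finset

/-! ### The star inequality near density one -/

/-- Second order upper bound for `x ^ s` around `y` on the unit interval. -/
theorem pow_le_taylor_two {x y : ℝ} (hx0 : 0 ≤ x) (hx1 : x ≤ 1) (hy0 : 0 ≤ y) (hy1 : y ≤ 1)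
    (m : ℕ) : x ^ (m + 1) ≤ y ^ (m + 1) + (m + 1) * y ^ m * (x - y)
      + (m + 1) * m / 2 * (x - y) ^ 2 := by
  induction m with
  | zero => simp
  | succ m ih =>
    have h1 : x * x ^ (m + 1) ≤ x * (y ^ (m + 1) + (m + 1) * y ^ m * (x - y)
      + (m + 1) * m / 2 * (x - y) ^ 2) := mul_le_mul_of_nonneg_left ih hx0
    have h2 : (m + 1 : ℝ) * y ^ m * (x - y) ^ 2 ≤ (m + 1) * 1 * (x - y) ^ 2 := by
      gcongr
      exact pow_le_one₀ hy0 hy1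
    have h3 : ((m + 1) * m / 2 * (x - y) ^ 2) * x ≤ ((m + 1) * m / 2 * (x - y) ^ 2) * 1 := by
      gcongr
    push_cast
    calc x ^ (m + 1 + 1) = x * x ^ (m + 1) := by ring
      _ ≤ _ := h1
      _ = y ^ (m + 1 + 1) + (m + 1 + 1) * y ^ (m + 1) * (x - y)
          + (m + 1) * y ^ m * (x - y) ^ 2 + ((m + 1) * m / 2 * (x - y) ^ 2) * x := by ring
      _ ≤ y ^ (m + 1 + 1) + (m + 1 + 1) * y ^ (m + 1) * (x - y)
          + (m + 1) * 1 * (x - y) ^ 2 + ((m + 1) * m / 2 * (x - y) ^ 2) * 1 := by gcongr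
      _ = _ := by ring

/-- Convexity of `p ↦ p ^ (k / 2)`, written in terms of square roots. -/
theorem tangent_sq_le_pow {x y : ℝ} (hx : 0 ≤ x) (hy : 0 ≤ y) (k : ℕ) :
    y ^ (k + 2) + (k + 2) / 2 * y ^ k * (x ^ 2 - y ^ 2) ≤ x ^ (k + 2) := by
  induction k with
  | zero => simp
  | succ k ih =>
    have h1 := mul_le_mul_of_nonneg_left ih hx
    have h2 : 0 ≤ (x - y) ^ 2 * y ^ k * ((k + 2) / 2 * x + (k + 1) / 2 * y) := by positivity
    push_cast
    calc _ = x * (y ^ (k + 2) + (k + 2) / 2 * y ^ k * (x ^ 2 - y ^ 2))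
        - (x - y) ^ 2 * y ^ k * ((k + 2) / 2 * x + (k + 1) / 2 * y) := by ring
      _ ≤ x * x ^ (k + 2) := by linarith
      _ = _ := by ring

/-- Makes the quadratic Taylor term linear: the larger of `u`, `v` bounds one factor of the square,
and its a priori bound `t` or `c` the other. -/
theorem sub_sq_le {u v t c : ℝ} (hu : 0 ≤ u) (hv : 0 ≤ v) (hut : u ≤ t) (hc : 0 ≤ c)
    (hvu : v - u ≤ c) : (u - v) ^ 2 ≤ t * u + c * v := by
  rcases le_total u v with h | h
  · calc (u - v) ^ 2 = (v - u) * (v - u) := by ring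
      _ ≤ c * v := mul_le_mul hvu (by linarith) (by linarith) hc
      _ ≤ t * u + c * v := le_add_of_nonneg_left (mul_nonneg (hu.trans hut) hu)
  · calc (u - v) ^ 2 = (u - v) * (u - v) := by ring
      _ ≤ t * u := mul_le_mul (by linarith) (by linarith) (by linarith) (hu.trans hut)
      _ ≤ t * u + c * v := le_add_of_nonneg_right (mul_nonneg hc hv)

/-- The right side lies above its tangent at `p = (1 - t) ^ 2`. Subtracting the left side from the
tangent cancels the constant term and leaves a linear form in `A`, `B`, `Y` with coefficients `cA`,
`cB`, `cY`, all nonnegative. -/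
theorem sqrt_pow_lower_bound {m : ℕ} {θ t A B Y p : ℝ} (hθs : (m + 2) * θ = 1 / 2)
    (ht0 : 0 ≤ t) (ht1 : t ≤ 1) (htm : (m + 2) ^ 2 * t ≤ θ) (hA : 0 ≤ A) (hB : 0 ≤ B)
    (hY : 0 ≤ Y) (hp : p = (1 - t) ^ 2 + A + 2 * B - Y) (hp0 : 0 ≤ p) :
    (1 - θ) * (A + B) + ((1 - t) * (1 - t) ^ (m + 2) + (m + 2) * (1 - t) ^ (m + 1) * (B - Y)
      + (m + 2) * (m + 1) / 2 * (t * B + θ * Y)) ≤ √p ^ (m + 3) := by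
  have hm : (0 : ℝ) ≤ m := Nat.cast_nonneg m
  have hb0 : 0 ≤ 1 - t := by linarith
  have htan := tangent_sq_le_pow (Real.sqrt_nonneg p) hb0 (m + 1)
  rw [Real.sq_sqrt hp0] at htan
  have hw1 : (1 - t) ^ (m + 1) ≤ 1 := pow_le_one₀ hb0 (by linarith)
  have hwt : 1 - (m + 1) * t ≤ (1 - t) ^ (m + 1) := by
    have := one_add_mul_le_pow (a := -t) (by linarith) (m + 1)
    push_cast at this
    calc _ = 1 + (m + 1) * -t := by ring
      _ ≤ _ := this
      _ = _ := by ring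
  have hbb : (1 - t) * (1 - t) ^ (m + 2) = (1 - t) ^ (m + 1 + 2) := by ring
  rw [hbb]
  generalize (1 - t) ^ (m + 1) = w at *
  have hmt : 0 ≤ m * t := mul_nonneg hm ht0
  have hmmt : 0 ≤ m * (m * t) := mul_nonneg hm hmt
  have hmθ : 0 ≤ θ := by
    rw [show θ = 1 / (2 * (m + 2)) by field_simp; linarith]; positivity
  have hθ : θ ≤ 1 / 4 := by
    have := mul_nonneg hm hmθ
    linarith
  -- The coefficient that forces `t` to be small compared with `θ`: it needs `(m + 1) * (m + 4) / 2
  -- * t ≤ θ`.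
  have cB : 0 ≤ w - 1 + θ - (m + 2) * (m + 1) / 2 * t := by linarith
  have hwθ : 1 - θ ≤ w := by
    have : 0 ≤ (m + 2) * (m + 1) / 2 * t := by positivity
    linarith
  have cA : 0 ≤ (m + 3) / 2 * w - (1 - θ) := by
    have := mul_nonneg hm (show 0 ≤ w by linarith)
    linarith
  have cY : 0 ≤ (m + 1) / 2 * w - (m + 2) * (m + 1) / 2 * θ := by
    have : (m + 1) / 2 * w - (m + 2) * (m + 1) / 2 * θ = (m + 1) / 2 * (w - 1 / 2) := by
      linear_combination -(m + 1 : ℝ) / 2 * hθs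
    rw [this]
    exact mul_nonneg (by positivity) (by linarith)
  have f1 := mul_nonneg cA hA
  have f2 := mul_nonneg cB hB
  have f3 := mul_nonneg cY hY
  refine le_trans ?_ htan
  push_cast
  rw [hp, ← sub_nonneg]
  refine (add_nonneg (add_nonneg f1 f2) f3).trans_eq ?_
  ring

/-- Among symmetric `[0, 1]`-valued kernels on a probability space whose density is close to `1`,
cliques maximise the density of stars with `m + 2` leaves. -/
theorem star_density_le {X : Type*} [Fintype X] (μ : X → ℝ) (hμ : ∀ x, 0 ≤ μ x)
    (hμ1 : ∑ x, μ x = 1) (a : X → X → ℝ) (ha0 : ∀ x y, 0 ≤ a x y) (ha1 : ∀ x y, a x y ≤ 1)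
    (hsymm : ∀ x y, a x y = a y x) (d : X → ℝ) (hd : ∀ x, d x = ∑ y, μ y * a x y) (m : ℕ)
    (hp : 1 - 1 / (4 * (m + 2 : ℝ) ^ 4) ≤ ∑ x, μ x * d x) :
    ∑ x, μ x * d x ^ (m + 2) ≤ √(∑ x, μ x * d x) ^ (m + 3) := by
  classical
  set p := ∑ x, μ x * d x with hpdef
  set θ : ℝ := 1 / (2 * (m + 2)) with hθ
  have hθ0 : 0 < θ := by positivity
  have hθs : (m + 2) * θ = 1 / 2 := by rw [hθ]; field_simp
  have hd0 : ∀ x, 0 ≤ d x := fun x => by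
    rw [hd]; exact sum_nonneg fun y _ => mul_nonneg (hμ y) (ha0 x y)
  have hd1 : ∀ x, d x ≤ 1 := fun x => by
    rw [hd, ← hμ1]; exact sum_le_sum fun y _ => mul_le_of_le_one_right (hμ y) (ha1 x y)
  have hsplit (f : X → ℝ) : ∑ x, f x = ∑ x with d x ≤ 1 - θ, f x + ∑ x with ¬ d x ≤ 1 - θ, f x :=
    (sum_filter_add_sum_filter_not univ _ f).symm
  set L : Finset X := {x | d x ≤ 1 - θ} with hL
  set S : Finset X := {x | ¬ d x ≤ 1 - θ} with hS
  set t := ∑ x ∈ L, μ x with ht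
  have ht0 : 0 ≤ t := sum_nonneg fun x _ => hμ x
  have hb : ∑ x ∈ S, μ x = 1 - t := by have := hsplit μ; linarith
  set b := 1 - t with hbdef
  have hb0 : 0 ≤ b := hb ▸ sum_nonneg fun x _ => hμ x
  have hb1 : b ≤ 1 := by linarith
  -- `u` is the weight towards the low-degree part `L`, `v` the weight missing towards `S`, so `d =
  -- b + u - v`.
  set u : X → ℝ := fun x => ∑ y ∈ L, μ y * a x y with hu
  set v : X → ℝ := fun x => ∑ y ∈ S, μ y * (1 - a x y) with hv
  have hu0 : ∀ x, 0 ≤ u x := fun x => sum_nonneg fun y _ => mul_nonneg (hμ y) (ha0 x y)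
  have hut : ∀ x, u x ≤ t := fun x =>
    sum_le_sum fun y _ => mul_le_of_le_one_right (hμ y) (ha1 x y)
  have hv0 : ∀ x, 0 ≤ v x := fun x =>
    sum_nonneg fun y _ => mul_nonneg (hμ y) (sub_nonneg.2 (ha1 x y))
  have hduv : ∀ x, d x = b + u x - v x := fun x => by
    have : v x = b - ∑ y ∈ S, μ y * a x y := by
      simp only [hv, mul_sub, mul_one, sum_sub_distrib, hb]
    rw [hd, hsplit, this]; simp only [hu]; ring
  set A := ∑ x ∈ L, μ x * u x with hA
  set B := ∑ x ∈ S, μ x * u x with hB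
  set Y := ∑ x ∈ S, μ x * v x with hY
  have hA0 : 0 ≤ A := sum_nonneg fun x _ => mul_nonneg (hμ x) (hu0 x)
  have hB0 : 0 ≤ B := sum_nonneg fun x _ => mul_nonneg (hμ x) (hu0 x)
  have hY0 : 0 ≤ Y := sum_nonneg fun x _ => mul_nonneg (hμ x) (hv0 x)
  have hLd : ∑ x ∈ L, μ x * d x = A + B := by
    rw [← hsplit fun x => μ x * u x]
    simp only [hu, hd, mul_sum]
    rw [sum_comm' (t' := univ) (s' := fun _ => L) (by simp)]
    exact sum_congr rfl fun x _ => sum_congr rfl fun y _ => by rw [hsymm x y]; ring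
  have hSd : ∑ x ∈ S, μ x * d x = b ^ 2 + B - Y := by
    simp only [hduv, mul_add, mul_sub, sum_add_distrib, sum_sub_distrib, ← sum_mul, hb, hB, hY]
    ring
  have hpe : p = b ^ 2 + A + 2 * B - Y := by rw [hpdef, hsplit, hLd, hSd]; ring
  -- Markov: each point of `L` misses at least `θ` of its degree.
  have htθ : t * θ ≤ 1 - p := by
    have h1 : 1 - p = ∑ x, μ x * (1 - d x) := by
      simp only [mul_sub, mul_one, sum_sub_distrib, hμ1, hpdef]
    rw [h1, hsplit, ht, sum_mul]
    have h2 : 0 ≤ ∑ x ∈ S, μ x * (1 - d x) :=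
      sum_nonneg fun x _ => mul_nonneg (hμ x) (sub_nonneg.2 (hd1 x))
    have h3 : ∑ x ∈ L, μ x * θ ≤ ∑ x ∈ L, μ x * (1 - d x) := by
      refine sum_le_sum fun x hx => mul_le_mul_of_nonneg_left ?_ (hμ x)
      rw [hL, mem_filter] at hx
      linarith [hx.2]
    linarith
  have htm : (m + 2) ^ 2 * t ≤ θ := by
    have h1 : (1 : ℝ) / (4 * (m + 2 : ℝ) ^ 4) = θ * (θ / (m + 2) ^ 2) := by
      rw [hθ]; field_simp; ring
    have h2 : t ≤ θ / (m + 2) ^ 2 := by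
      refine le_of_mul_le_mul_left ?_ hθ0
      rw [← h1]; linarith
    rwa [le_div_iff₀' (by positivity)] at h2
  have hLs : ∑ x ∈ L, μ x * d x ^ (m + 2) ≤ (1 - θ) * (A + B) := by
    rw [← hLd, mul_sum]
    refine sum_le_sum fun x hx => ?_
    rw [hL, mem_filter] at hx
    have h1 : d x ^ (m + 2) ≤ (1 - θ) * d x := by
      calc d x ^ (m + 2) = d x ^ m * d x * d x := by ring
        _ ≤ 1 * d x * d x := by
          gcongr
          · exact hd0 x
          · exact hd0 x
          · exact pow_le_one₀ (hd0 x) (hd1 x)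
        _ ≤ (1 - θ) * d x := by
          rw [one_mul]; exact mul_le_mul_of_nonneg_right hx.2 (hd0 x)
    calc μ x * d x ^ (m + 2) ≤ μ x * ((1 - θ) * d x) := mul_le_mul_of_nonneg_left h1 (hμ x)
      _ = _ := by ring
  set C : ℝ := (m + 2) * (m + 1) / 2 with hC
  have hC0 : 0 ≤ C := by positivity
  have hSs : ∑ x ∈ S, μ x * d x ^ (m + 2) ≤
      b * b ^ (m + 2) + (m + 2) * b ^ (m + 1) * (B - Y) + C * (t * B + θ * Y) := by
    have h1 : ∀ x ∈ S, μ x * d x ^ (m + 2) ≤ μ x * (b ^ (m + 2)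
        + (m + 2) * b ^ (m + 1) * (u x - v x) + C * (t * u x + θ * v x)) := by
      intro x hx
      rw [hS, mem_filter] at hx
      refine mul_le_mul_of_nonneg_left ?_ (hμ x)
      have h2 := pow_le_taylor_two (hd0 x) (hd1 x) hb0 hb1 (m + 1)
      have h3 : d x - b = u x - v x := by rw [hduv]; ring
      -- On `S`, `d > 1 - θ` and `b ≤ 1` give `v - u = b - d ≤ θ`.
      have h4 : (u x - v x) ^ 2 ≤ t * u x + θ * v x := by
        have h5 : v x - u x ≤ θ := by linarith [hx.2, hduv x]
        exact sub_sq_le (hu0 x) (hv0 x) (hut x) hθ0.le h5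
      rw [h3] at h2
      push_cast at h2
      have h6 := mul_le_mul_of_nonneg_left h4 hC0
      rw [hC] at h6 ⊢
      have e1 : (m + 1 + 1 : ℝ) = m + 2 := by ring
      rw [e1] at h2
      exact h2.trans (by gcongr)
    refine (sum_le_sum h1).trans_eq ?_
    have h7 : ∀ x, μ x * (b ^ (m + 2) + (m + 2) * b ^ (m + 1) * (u x - v x)
        + C * (t * u x + θ * v x)) = b ^ (m + 2) * μ x
        + ((m + 2) * b ^ (m + 1) + C * t) * (μ x * u x)
        + (C * θ - (m + 2) * b ^ (m + 1)) * (μ x * v x) := fun x => by ring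
    simp only [h7, sum_add_distrib, ← mul_sum, hb, ← hB, ← hY]
    ring
  have hp0 : 0 ≤ p := sum_nonneg fun x _ => mul_nonneg (hμ x) (hd0 x)
  rw [hsplit]
  exact (add_le_add hLs hSs).trans
    (sqrt_pow_lower_bound hθs ht0 (by linarith) htm hA0 hB0 hY0 hpe hp0)

/-- The star inequality for graphs: if `G` has `e` edges and is close to complete then
`∑ d(x) ^ s ≤ √(2 e) ^ (s + 1)`. -/
theorem SimpleGraph.sum_degree_pow_le {X : Type*} [Fintype X] (G : SimpleGraph X)
    [DecidableRel G.Adj] {s : ℕ} (hs : 1 ≤ s) {K : ℝ} (hsK : s ≤ K)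
    (he : (1 - 1 / (4 * K ^ 4)) * (Fintype.card X : ℝ) ^ 2 ≤ 2 * #G.edgeFinset) :
    (∑ x, G.degree x ^ s : ℝ) ≤ √(2 * #G.edgeFinset) ^ (s + 1) := by
  have hdeg : (∑ x, G.degree x : ℝ) = 2 * #G.edgeFinset := by
    exact_mod_cast G.sum_degrees_eq_twice_card_edges
  -- For `s = 1` both sides equal `2e`.
  obtain rfl | hs2 := eq_or_lt_of_le hs
  · rw [Real.sq_sqrt (by positivity)]
    simp [hdeg]
  obtain ⟨m, rfl⟩ := Nat.exists_eq_add_of_le' hs2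
  rcases isEmpty_or_nonempty X with hX | hX
  · simp only [univ_eq_empty, sum_empty]; positivity
  set n : ℝ := (Fintype.card X : ℝ) with hn
  have hn0 : 0 < n := by rw [hn]; exact_mod_cast Fintype.card_pos
  have hdn : ∀ x, (G.degree x : ℝ) / n = ∑ y, 1 / n * (if G.Adj x y then 1 else 0) := fun x => by
    rw [← mul_sum, sum_boole, ← SimpleGraph.card_neighborFinset_eq_degree,
      SimpleGraph.neighborFinset_eq_filter]
    ring
  have hsum : ∑ x, 1 / n * ((G.degree x : ℝ) / n) = 2 * #G.edgeFinset / n ^ 2 := by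
    rw [← mul_sum, ← sum_div, hdeg]; field_simp
  have key := star_density_le (fun _ : X => 1 / n) (fun _ => by positivity)
    (by simp [hn0.ne', ← hn]) (fun x y => if G.Adj x y then 1 else 0)
    (fun x y => by split_ifs <;> simp) (fun x y => by split_ifs <;> simp)
    (fun x y => by simp only [G.adj_comm x y]) (fun x => G.degree x / n) hdn m (by
      rw [hsum, le_div_iff₀ (by positivity)]
      refine le_trans ?_ he
      have hmK : (m + 2 : ℝ) ≤ K := by exact_mod_cast hsK
      gcongr)
  rw [hsum, Real.sqrt_div (by positivity), Real.sqrt_sq hn0.le] at key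
  simp only [div_pow, ← mul_sum, ← sum_div] at key
  have : 1 / n * ((∑ x, (G.degree x : ℝ) ^ (m + 2)) / n ^ (m + 2))
      = (∑ x, (G.degree x : ℝ) ^ (m + 2)) / n ^ (m + 3) := by
    field_simp
    ring
  rw [this, div_le_div_iff_of_pos_right (by positivity)] at key
  exact key

/-! ### Reduction to star forests -/

/-- Every finite graph has a spanning subgraph all of whose components are stars, with the same
isolated vertices; `c` maps a vertex to the centre of its star. -/
theorem SimpleGraph.exists_star_forest {V : Type*} [Fintype V] (H : SimpleGraph V) :
    ∃ c : V → V, (∀ v, c (c v) = c v) ∧ (∀ v, c v ≠ v → H.Adj v (c v)) ∧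
      ∀ v, (∃ w, H.Adj v w) → ∃ w, w ≠ c v ∧ c w = c v := by
  classical
  -- In a minimal edge cover every edge has an end of degree one, as otherwise it could be deleted.
  obtain ⟨F, hF⟩ := exists_minimal_of_wellFoundedLT
    (fun F : SimpleGraph V => F ≤ H ∧ ∀ v, (∃ w, H.Adj v w) → ∃ w, F.Adj v w)
    ⟨H, le_rfl, fun _ h => h⟩
  have hleaf : ∀ u v, F.Adj u v → (∀ w, F.Adj u w → w = v) ∨ (∀ w, F.Adj v w → w = u) := by
    intro u v huv
    by_contra! hcon
    obtain ⟨⟨x, hx, hxv⟩, y, hy, hyu⟩ := hcon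
    have hdel : F ≤ F.deleteEdges {s(u, v)} := by
      refine hF.2 ⟨(F.deleteEdges_le _).trans hF.1.1, fun w hw => ?_⟩ (F.deleteEdges_le _)
      obtain ⟨z, hz⟩ := hF.1.2 w hw
      by_cases hwz : s(w, z) = s(u, v)
      · rw [Sym2.eq_iff] at hwz
        rcases hwz with ⟨rfl, rfl⟩ | ⟨rfl, rfl⟩
        · exact ⟨x, by simp [SimpleGraph.deleteEdges_adj, hx, hxv, hx.ne']⟩
        · exact ⟨y, by simp [SimpleGraph.deleteEdges_adj, hy, hyu, hy.ne']⟩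
      · exact ⟨z, by simpa [SimpleGraph.deleteEdges_adj, hz] using hwz⟩
    have := hdel huv
    simp [SimpleGraph.deleteEdges_adj] at this
  let leaf : V → Prop := fun v => ∃! u, F.Adj v u
  let g : V → V := fun v => if h : leaf v then h.choose else v
  have hg : ∀ v, leaf v → F.Adj v (g v) := fun v hv => by
    simp only [g, dif_pos hv]; exact hv.choose_spec.1
  have hgu : ∀ v u, leaf v → F.Adj v u → g v = u := fun v u hv hu => hv.unique (hg v hv) hu
  let r := Fintype.equivFin V
  -- A leaf goes to its only neighbour. In a single-edge component both ends are leaves, and the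
  -- numbering `r` makes the smaller one the centre.
  let c : V → V := fun v => if leaf v ∧ ¬ (leaf (g v) ∧ r v < r (g v)) then g v else v
  have hc1 : ∀ v, leaf v → ¬ (leaf (g v) ∧ r v < r (g v)) → c v = g v := fun v h1 h2 =>
    if_pos ⟨h1, h2⟩
  have hgg : ∀ v, leaf v → leaf (g v) → g (g v) = v := fun v h1 h2 =>
    hgu _ _ h2 (hg v h1).symm
  refine ⟨c, fun v => ?_, fun v hv => ?_, fun v hv => ?_⟩
  · by_cases h : leaf v ∧ ¬ (leaf (g v) ∧ r v < r (g v))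
    · rw [hc1 v h.1 h.2]
      refine if_neg fun h' => h'.2 ?_
      have hgv := hgg v h.1 h'.1
      rw [hgv]
      refine ⟨h.1, lt_of_le_of_ne (not_lt.1 fun h3 => h.2 ⟨h'.1, h3⟩) fun h3 => ?_⟩
      exact (hg v h.1).ne' (r.injective h3)
    · have : c v = v := if_neg h
      rw [this, this]
  · by_cases h : leaf v ∧ ¬ (leaf (g v) ∧ r v < r (g v))
    · rw [hc1 v h.1 h.2]
      exact hF.1.1 (hg v h.1)
    · exact absurd (if_neg h) hv
  · by_cases h : leaf v ∧ ¬ (leaf (g v) ∧ r v < r (g v))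
    · refine ⟨v, ?_, rfl⟩
      rw [hc1 v h.1 h.2]
      exact (hg v h.1).ne
    · have hcv : c v = v := if_neg h
      rw [hcv]
      by_cases hv' : leaf v
      · have h2 : leaf (g v) ∧ r v < r (g v) := by
          by_contra h3
          exact h ⟨hv', h3⟩
        refine ⟨g v, (hg v hv').ne', ?_⟩
        rw [hc1 _ h2.1, hgg v hv' h2.1]
        rw [hgg v hv' h2.1]
        exact fun h3 => lt_asymm h2.2 h3.2
      · obtain ⟨u, hu⟩ := hF.1.2 v hv
        have hul : ∀ w, F.Adj u w → w = v := by
          rcases hleaf v u hu with h1 | h1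
          · exact absurd ⟨u, hu, h1⟩ hv'
          · exact h1
        have hlu : leaf u := ⟨v, hu.symm, hul⟩
        have hguv := hgu u v hlu hu.symm
        refine ⟨u, hu.ne', ?_⟩
        rw [hc1 u hlu, hguv]
        rw [hguv]
        exact fun h3 => hv' h3.1

theorem SimpleGraph.labelledCopyCount_eq_natCard {V X : Type*} [Fintype V] [Fintype X]
    (G : SimpleGraph X) (H : SimpleGraph V) : G.labelledCopyCount H = Nat.card (Copy H G) := by
  rw [SimpleGraph.labelledCopyCount, Fintype.card_eq_nat_card]

/-- A spanning star forest bounds the number of labelled copies by a product of star counts. -/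
theorem SimpleGraph.labelledCopyCount_le_prod_stars {V X : Type*} [Fintype V] [DecidableEq V]
    [Fintype X] (H : SimpleGraph V) (G : SimpleGraph X) [DecidableRel G.Adj] (c : V → V)
    (hcc : ∀ v, c (c v) = c v) (hadj : ∀ v, c v ≠ v → H.Adj v (c v)) :
    G.labelledCopyCount H ≤
      ∏ z : {z // c z = z}, ∑ x, G.degree x ^ #{v | c v = z ∧ v ≠ z} := by
  classical
  let c' : {v // c v ≠ v} → {z // c z = z} := fun v => ⟨c v, hcc v⟩
  -- Arbitrary images of the centres, then for each leaf a neighbour of the image of its centre.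
  let T := Σ ψ : {z // c z = z} → X, ∀ v : {v // c v ≠ v}, {x // x ∈ G.neighborFinset (ψ (c' v))}
  let ι : Copy H G → T := fun f => ⟨fun z => f z, fun v => ⟨f v, by
    rw [SimpleGraph.mem_neighborFinset]
    exact (f.toHom.map_adj (hadj v v.2)).symm⟩⟩
  have hι : Function.Injective ι := by
    intro f f' h
    have h1 : ∀ z, c z = z → f z = f' z := fun z hz =>
      congrFun (congrArg Sigma.fst h) ⟨z, hz⟩
    have h2 : ∀ t t' : T, t = t' → ∀ v, (t.2 v : X) = t'.2 v := by
      rintro t _ rfl v; rfl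
    refine DFunLike.ext _ _ fun v => ?_
    by_cases hv : c v = v
    · exact h1 v hv
    · exact h2 _ _ h ⟨v, hv⟩
  calc G.labelledCopyCount H = Nat.card (Copy H G) := G.labelledCopyCount_eq_natCard H
    _ ≤ Nat.card T := Nat.card_le_card_of_injective ι hι
    _ = Fintype.card T := Nat.card_eq_fintype_card
    _ = ∑ ψ : {z // c z = z} → X, ∏ v : {v // c v ≠ v}, G.degree (ψ (c' v)) := by
        simp only [T, Fintype.card_sigma, Fintype.card_pi, Fintype.card_coe,
          SimpleGraph.card_neighborFinset_eq_degree]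
    _ = ∑ ψ : {z // c z = z} → X, ∏ z, G.degree (ψ z) ^ #{v | c v = z ∧ v ≠ z} := by
        refine sum_congr rfl fun ψ _ => ?_
        rw [← Fintype.prod_fiberwise c']
        refine prod_congr rfl fun z _ => ?_
        rw [prod_congr rfl fun v hv => by rw [v.2], prod_const]
        congr 1
        rw [card_univ, ← Fintype.card_coe]
        refine Fintype.card_congr
          { toFun := fun v => ⟨v.1, ?_⟩
            invFun := fun v => ⟨⟨v, ?_⟩, ?_⟩
            left_inv := fun v => rfl
            right_inv := fun v => rfl }
        · have hv : c v.1 = z := congrArg Subtype.val v.2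
          exact mem_filter.2 ⟨mem_univ _, hv, fun h => v.1.2 (hv.trans h.symm)⟩
        · have hv := (mem_filter.1 v.2).2
          rw [hv.1]
          exact hv.2.symm
        · exact Subtype.ext (mem_filter.1 v.2).2.1
    _ = _ := by rw [Fintype.prod_sum]

/-- If the counts of all nontrivial stars in `G` are at most those in a clique on `R` vertices then
so is the count of every graph, up to isolated vertices. -/
theorem SimpleGraph.labelledCopyCount_le_prod {V X : Type*} [Fintype V] [Fintype X]
    (H : SimpleGraph V) (G : SimpleGraph X) [DecidableRel G.Adj]
    [DecidablePred fun v => ∃ w, H.Adj v w] {R : ℝ}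
    (hstar : ∀ s, 1 ≤ s → s ≤ Fintype.card V → (∑ x, G.degree x ^ s : ℝ) ≤ R ^ (s + 1)) :
    (G.labelledCopyCount H : ℝ) ≤
      ∏ v, if ∃ w, H.Adj v w then R else (Fintype.card X : ℝ) := by
  classical
  obtain ⟨c, hcc, hadj, hfib⟩ := H.exists_star_forest
  have h1 : (G.labelledCopyCount H : ℝ) ≤
      ∏ z : {z // c z = z}, ∑ x, (G.degree x : ℝ) ^ #{v | c v = z ∧ v ≠ z} := by
    exact_mod_cast H.labelledCopyCount_le_prod_stars G c hcc hadj
  refine h1.trans ?_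
  let c' : V → {z // c z = z} := fun v => ⟨c v, hcc v⟩
  rw [← Finset.prod_fiberwise univ c']
  refine prod_le_prod (fun z _ => sum_nonneg fun x _ => by positivity) fun z _ => ?_
  have hz := z.2
  have hfz : univ.filter (fun v => c' v = z) =
      insert (z : V) ({v | c v = z ∧ v ≠ z} : Finset V) := by
    ext v
    simp only [c', Subtype.ext_iff, mem_filter, mem_univ, true_and, mem_insert]
    by_cases hv : v = z
    · simp [hv, hz]
    · simp [hv]
  have hzn : (z : V) ∉ ({v | c v = z ∧ v ≠ z} : Finset V) := by simp
  have hnon : ∀ v ∈ ({v | c v = z ∧ v ≠ z} : Finset V), H.Adj v z := by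
    intro v hv
    rw [mem_filter] at hv
    have := hadj v (by rw [hv.2.1]; exact hv.2.2.symm)
    rwa [hv.2.1] at this
  rw [hfz, prod_insert hzn, prod_congr rfl fun v hv => if_pos ⟨_, hnon v hv⟩, prod_const]
  by_cases hiso : ∃ w, H.Adj z w
  · rw [if_pos hiso, ← pow_succ']
    -- A non-isolated centre has a leaf, so `hstar` applies with `s ≥ 1`.
    obtain ⟨w, hw1, hw2⟩ := hfib z hiso
    rw [hz] at hw1 hw2
    exact hstar _ (card_pos.2 ⟨w, by simp [hw1, hw2]⟩) (card_le_univ _)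
  · rw [if_neg hiso]
    have : ({v | c v = z ∧ v ≠ z} : Finset V) = ∅ := by
      refine eq_empty_of_forall_notMem fun v hv => hiso ⟨v, (hnon v hv).symm⟩
    simp [this]

/-! ### Injective choices; labelled and unlabelled copies -/

/-- Among the choices of a point from each of `k` sets with at least `a` points, at most the
proportion `k ^ 2 / a` is not injective. -/
theorem card_mul_le_card_injective_mul {V X : Type*} [Fintype V] [DecidableEq V] [DecidableEq X]
    (A : V → Finset X) (a : ℕ) (hA : ∀ v, a ≤ #(A v)) :
    (∏ v, #(A v)) * a ≤
      #{f ∈ Fintype.piFinset A | Function.Injective f} * a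
        + Fintype.card V ^ 2 * ∏ v, #(A v) := by
  have hbad : ∀ p : V × V, p.1 ≠ p.2 →
      #{f ∈ Fintype.piFinset A | f p.1 = f p.2} * a ≤ ∏ v, #(A v) := by
    rintro ⟨u, v⟩ huv
    rw [← Fintype.card_piFinset]
    -- Overwriting `f u` by any point of `A u` loses nothing, since the old value is still visible
    -- at `v`.
    refine (Nat.mul_le_mul_left _ (hA u)).trans ?_
    rw [← card_product]
    refine card_le_card_of_injOn (fun q => Function.update q.1 u q.2) ?_ ?_
    · rintro ⟨f, x⟩ hq
      simp only [coe_product, Set.mem_prod, mem_coe, mem_filter, Fintype.mem_piFinset] at hq ⊢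
      intro w
      by_cases hw : w = u
      · subst hw; simpa using hq.2
      · simpa [hw] using hq.1.1 w
    · rintro ⟨f, x⟩ hq ⟨f', x'⟩ hq' h
      simp only [coe_product, Set.mem_prod, mem_coe, mem_filter] at hq hq' h
      have hx : x = x' := by simpa using congrFun h u
      have hne : ∀ w, w ≠ u → f w = f' w := fun w hw => by simpa [hw] using congrFun h w
      refine Prod.ext (funext fun w => ?_) hx
      by_cases hw : w = u
      · subst hw
        change f w = f' w
        rw [hq.1.2, hq'.1.2]
        exact hne v (Ne.symm huv)
      · exact hne w hw
  have hsub : Fintype.piFinset A ⊆ {f ∈ Fintype.piFinset A | Function.Injective f} ∪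
      ({p : V × V | p.1 ≠ p.2} : Finset (V × V)).biUnion
        fun p => {f ∈ Fintype.piFinset A | f p.1 = f p.2} := by
    intro f hf
    by_cases hinj : Function.Injective f
    · simp [hinj, mem_union, mem_filter, hf]
    · obtain ⟨u, v, h1, h2⟩ : ∃ u v, f u = f v ∧ u ≠ v := by
        simpa [Function.Injective] using hinj
      refine mem_union_right _ (mem_biUnion.2 ⟨(u, v), by simpa using h2, ?_⟩)
      exact mem_filter.2 ⟨hf, h1⟩
  rw [← Fintype.card_piFinset]
  calc #(Fintype.piFinset A) * a
      ≤ (#{f ∈ Fintype.piFinset A | Function.Injective f} +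
          ∑ p : V × V with p.1 ≠ p.2, #{f ∈ Fintype.piFinset A | f p.1 = f p.2}) * a :=
        Nat.mul_le_mul_right _ <| (card_le_card hsub).trans <|
          (card_union_le _ _).trans <| Nat.add_le_add_left card_biUnion_le _
    _ ≤ _ := by
        rw [add_mul, sum_mul]
        refine Nat.add_le_add_left ?_ _
        refine (sum_le_card_nsmul _ _ _ fun p hp => hbad p (mem_filter.1 hp).2).trans ?_
        rw [smul_eq_mul, Fintype.card_piFinset]
        refine Nat.mul_le_mul_right _ ((card_le_univ _).trans_eq ?_)
        rw [Fintype.card_prod, sq]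

/-- Every unlabelled copy of `H` comes from as many labelled ones as `H` has automorphisms. -/
theorem SimpleGraph.labelledCopyCount_eq_copyCount_mul {V X : Type*} [Fintype V] [Fintype X]
    (H : SimpleGraph V) (G : SimpleGraph X) :
    G.labelledCopyCount H = G.copyCount H * Nat.card (H ≃g H) := by
  classical
  have hmaps : ∀ f ∈ (univ : Finset (Copy H G)),
      f.toSubgraph ∈ ({G' | Nonempty (H ≃g G'.coe)} : Finset G.Subgraph) := fun f _ =>
    mem_filter.2 ⟨mem_univ _, ⟨f.isoToSubgraph⟩⟩
  have h1 : G.labelledCopyCount H = #(univ : Finset (Copy H G)) := by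
    rw [G.labelledCopyCount_eq_natCard, card_univ, Fintype.card_eq_nat_card]
  have h2 : G.copyCount H = #({G' | Nonempty (H ≃g G'.coe)} : Finset G.Subgraph) := by
    rw [SimpleGraph.copyCount]
  rw [h1, card_eq_sum_card_fiberwise hmaps, h2]
  refine sum_const_nat fun G' hG' => ?_
  obtain ⟨e₀⟩ := (mem_filter.1 hG').2
  -- The labelled copies with image `G'` are the isomorphisms onto it, which are equinumerous with
  -- the automorphisms of `H`.
  have h3 : Nat.card (H ≃g G'.coe) = Nat.card {f : Copy H G // f.toSubgraph = G'} := by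
    refine Nat.card_eq_of_bijective
      (fun e => ⟨G'.coeCopy.comp e.toCopy, ?_⟩) ⟨fun e e' h => ?_, ?_⟩
    · have h4 : (G'.coeCopy.comp e.toCopy).toHom = G'.hom.comp e.toHom := rfl
      rw [Copy.toSubgraph, h4, Subgraph.map_comp]
      have h5 : Subgraph.map e.toHom (⊤ : H.Subgraph) = ⊤ := by
        ext x y
        · simp only [Subgraph.map_verts, Subgraph.verts_top, Set.image_univ]
          exact ⟨fun _ => trivial, fun _ => ⟨e.symm x, e.apply_symm_apply x⟩⟩
        · constructor
          · exact fun h => h.adj_sub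
          · intro h
            refine ⟨e.symm x, e.symm y, ?_, e.apply_symm_apply x, e.apply_symm_apply y⟩
            exact (Iso.map_adj_iff e.symm).2 h
      rw [h5]
      simp
    · ext v
      have h4 := congrArg (fun f => (f.1 : Copy H G) v) h
      exact h4
    · rintro ⟨f, rfl⟩
      exact ⟨f.isoToSubgraph, Subtype.ext (DFunLike.ext _ _ fun v => rfl)⟩
  have h6 : Nat.card (H ≃g H) = Nat.card (H ≃g G'.coe) :=
    Nat.card_congr
      { toFun := fun σ => σ.trans e₀
        invFun := fun e => e.trans e₀.symm
        left_inv := fun σ => by ext v; simp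
        right_inv := fun e => by ext v; simp }
  rw [h6, h3, Nat.card_eq_fintype_card, Fintype.card_subtype]

/-! ### Clique size and the quasi-clique -/

theorem Nat.succ_choose_two (n : ℕ) : (n + 1).choose 2 = n + n.choose 2 := by
  rw [Nat.choose_succ_succ' _ 1, Nat.choose_one_right]

theorem choose_two_cliqueSize_le (e : ℕ) : (cliqueSize e).choose 2 ≤ e := by
  obtain ⟨b, -, h⟩ := cliqueSize_spec e
  omega

theorem sub_choose_two_cliqueSize_lt (e : ℕ) : e - (cliqueSize e).choose 2 < cliqueSize e := by
  obtain ⟨b, hb, h⟩ := cliqueSize_spec e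
  omega

theorem lt_cliqueSize_succ_choose_two (e : ℕ) : e < (cliqueSize e + 1).choose 2 := by
  have h1 := sub_choose_two_cliqueSize_lt e
  rw [Nat.succ_choose_two]
  omega

theorem two_mul_le_cliqueSize_succ_sq (e : ℕ) : 2 * (e : ℝ) ≤ ((cliqueSize e : ℝ) + 1) ^ 2 := by
  have h1 : (e : ℝ) ≤ ((cliqueSize e + 1).choose 2 : ℕ) := by
    exact_mod_cast (lt_cliqueSize_succ_choose_two e).le
  rw [Nat.cast_choose_two] at h1
  push_cast at h1
  nlinarith [(cliqueSize e).cast_nonneg (α := ℝ)]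

theorem cliqueSize_le {n e : ℕ} (hn : 1 ≤ n) (he : e ≤ n.choose 2) : cliqueSize e ≤ n := by
  by_contra! h
  have h1 := Nat.choose_le_choose 2 (Nat.succ_le_of_lt h)
  have h2 := Nat.succ_choose_two n
  have h3 := choose_two_cliqueSize_le e
  simp only [Nat.succ_eq_add_one] at h1
  omega

/-- Each edge is counted at its larger end. This makes the quasi-clique a competitor in `maxCopies`.
-/
theorem ncard_edgeSet_quasiClique {n e : ℕ} (hn : 1 ≤ n) (he : e ≤ n.choose 2) :
    (quasiClique n e).edgeSet.ncard = e := by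
  classical
  have han := cliqueSize_le hn he
  have hae := choose_two_cliqueSize_le e
  have hb := sub_choose_two_cliqueSize_lt e
  have hadj : ∀ i j : Fin n, i < j → ((quasiClique n e).Adj i j ↔
      (j : ℕ) < cliqueSize e ∨ (j : ℕ) = cliqueSize e ∧ (i : ℕ) < e - (cliqueSize e).choose 2) := by
    intro i j hij
    have hij' : (i : ℕ) < j := hij
    simp only [quasiClique, max_eq_right hij'.le, min_eq_left hij'.le, ne_eq, hij.ne,
      not_false_eq_true, true_and]
  let g : ℕ → ℕ := fun j => if j < cliqueSize e then j else
    if j = cliqueSize e then e - (cliqueSize e).choose 2 else 0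
  have hgn : ∀ j, g j ≤ j := fun j => by simp only [g]; split_ifs <;> omega
  let T : Finset (Fin n × Fin n) := {p | (p.1 : ℕ) < g p.2}
  have hT : ∀ i j : Fin n, (i, j) ∈ T ↔ i < j ∧ (quasiClique n e).Adj i j := by
    intro i j
    simp only [T, mem_filter, mem_univ, true_and]
    constructor
    · intro h
      have hij : i < j := Fin.lt_def.2 (lt_of_lt_of_le h (hgn j))
      refine ⟨hij, (hadj i j hij).2 ?_⟩
      simp only [g] at h
      split_ifs at h <;> omega
    · rintro ⟨hij, h⟩
      have hij' : (i : ℕ) < j := hij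
      have := (hadj i j hij).1 h
      simp only [g]
      split_ifs <;> omega
  have hedge : (quasiClique n e).edgeSet = (fun p : Fin n × Fin n => s(p.1, p.2)) '' T := by
    ext x
    induction x with | _ i j => ?_
    simp only [SimpleGraph.mem_edgeSet, Set.mem_image, mem_coe, Prod.exists, hT]
    constructor
    · intro h
      rcases lt_or_gt_of_ne h.ne with hij | hij
      · exact ⟨i, j, ⟨hij, h⟩, rfl⟩
      · exact ⟨j, i, ⟨hij, h.symm⟩, Sym2.eq_swap⟩
    · rintro ⟨k, l, ⟨-, h⟩, hkl⟩
      rwa [← SimpleGraph.mem_edgeSet, ← hkl]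
  have hinj : Set.InjOn (fun p : Fin n × Fin n => s(p.1, p.2)) T := by
    rintro ⟨i, j⟩ h ⟨k, l⟩ h' heq
    have h1 := ((hT i j).1 h).1
    have h2 := ((hT k l).1 h').1
    rcases Sym2.eq_iff.1 heq with ⟨h3, h4⟩ | ⟨h3, h4⟩
    · exact Prod.ext h3 h4
    · simp only at h3 h4
      subst h3 h4
      exact absurd h1 h2.not_gt
  rw [hedge, hinj.ncard_image, Set.ncard_coe_finset]
  have hcard : #T = ∑ j : Fin n, g j := by
    rw [card_filter, Fintype.sum_prod_type_right]
    refine sum_congr rfl fun j _ => ?_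
    rw [← card_filter]
    dsimp only
    rw [Fin.card_filter_val_lt, min_eq_right ((hgn j).trans j.2.le)]
  have hsum : ∀ m, m ≤ cliqueSize e → ∑ j ∈ range m, g j = m.choose 2 := by
    intro m hm
    rw [sum_congr rfl fun j hj => if_pos ((mem_range.1 hj).trans_le hm), sum_range_id,
      Nat.choose_two_right]
  rw [hcard, Fin.sum_univ_eq_sum_range]
  -- If the clique fills all `n` vertices there is no extra vertex, and `he` forces the remainder to
  -- be zero.
  rcases han.eq_or_lt with h | h
  · rw [hsum n h.ge]
    rw [← h] at he ⊢
    omega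
  · obtain ⟨r, rfl⟩ := Nat.exists_eq_add_of_lt h
    rw [add_assoc, sum_range_add, hsum _ le_rfl, add_comm r, sum_range_add]
    simp [g]
    omega

/-- The copies of `H` in the quasi-clique include those whose nontrivial part is in the clique. -/
theorem card_injective_le_labelledCopyCount_quasiClique {V : Type*} [Fintype V] [DecidableEq V]
    (H : SimpleGraph V) (n e : ℕ) (A : V → Finset (Fin n))
    (hA : ∀ v w, H.Adj v w → ∀ x ∈ A v, (x : ℕ) < cliqueSize e) :
    #{f ∈ Fintype.piFinset A | Function.Injective f} ≤
      (quasiClique n e).labelledCopyCount H := by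
  classical
  have hf (f : {f // f ∈ ({f ∈ Fintype.piFinset A | Function.Injective f} : Finset _)}) :
      (∀ v, f.1 v ∈ A v) ∧ Function.Injective f.1 := by
    have h := mem_filter.1 f.2
    exact ⟨Fintype.mem_piFinset.1 h.1, h.2⟩
  let F (f : {f // f ∈ ({f ∈ Fintype.piFinset A | Function.Injective f} : Finset _)}) :
      SimpleGraph.Copy H (quasiClique n e) :=
    { toHom :=
        { toFun := f.1
          map_rel' := fun {v w} hvw => ⟨fun h => hvw.ne ((hf f).2 h), Or.inl <|
            max_lt (hA v w hvw _ ((hf f).1 v)) (hA w v hvw.symm _ ((hf f).1 w))⟩ }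
      injective' := (hf f).2 }
  rw [SimpleGraph.labelledCopyCount_eq_natCard, ← Fintype.card_coe, Fintype.card_eq_nat_card]
  refine Nat.card_le_card_of_injective F fun f f' h => Subtype.ext (funext fun v => ?_)
  exact congrArg (fun f : SimpleGraph.Copy H (quasiClique n e) => f v) h

/-! ### Asymptotic comparison -/

/-- Absorbs both losses into `1 + ε`: the factor `(1 + 1 / a) ^ k` from `√(2e) ≤ a + 1`, and the
proportion `k ^ 2 / a` of non-injective choices. -/
theorem exists_forall_one_add_inv_pow_mul_le (k : ℕ) {ε : ℝ} (hε : 0 < ε) :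
    ∃ a₀ : ℕ, ∀ a : ℕ, a₀ ≤ a →
      0 < a ∧ (1 + 1 / (a : ℝ)) ^ k * a ≤ (1 + ε) * (a - k ^ 2) := by
  have h0 : Filter.Tendsto (fun a : ℕ => 1 / (a : ℝ)) Filter.atTop (nhds 0) :=
    tendsto_one_div_atTop_nhds_zero_nat
  have h1 : Filter.Tendsto (fun a : ℕ => (1 + 1 / (a : ℝ)) ^ k) Filter.atTop (nhds 1) := by
    simpa using (h0.const_add 1).pow k
  have h2 : Filter.Tendsto (fun a : ℕ => (1 + ε) * (1 - k ^ 2 * (1 / (a : ℝ)))) Filter.atTop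
      (nhds (1 + ε)) := by
    simpa using ((h0.const_mul ((k : ℝ) ^ 2)).const_sub 1).const_mul (1 + ε)
  obtain ⟨a₀, ha₀⟩ := Filter.eventually_atTop.1
    ((h1.eventually_lt h2 (by linarith)).and (Filter.eventually_gt_atTop 0))
  refine ⟨a₀, fun a ha => ⟨(ha₀ a ha).2, ?_⟩⟩
  have ha0 : (0 : ℝ) < a := by exact_mod_cast (ha₀ a ha).2
  calc (1 + 1 / (a : ℝ)) ^ k * a ≤ (1 + ε) * (1 - k ^ 2 * (1 / (a : ℝ))) * a := by
        have := (ha₀ a ha).1.le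
        gcongr
    _ = _ := by field_simp

/-- If a graph with `e` edges is close to complete, then it has asymptotically at most as many
labelled copies of `H` as the quasi-clique. -/
theorem labelledCopyCount_le_quasiClique {V : Type*} [Fintype V] (H : SimpleGraph V) {n e : ℕ}
    {K ε : ℝ} (hn : 1 ≤ n) (hen : e ≤ n.choose 2) (hK : Fintype.card V ≤ K)
    (hdense : (1 - 1 / (4 * K ^ 4)) * (n : ℝ) ^ 2 ≤ 2 * e) (ha : 0 < cliqueSize e)
    (hε : (1 + 1 / (cliqueSize e : ℝ)) ^ Fintype.card V * cliqueSize e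
      ≤ (1 + ε) * (cliqueSize e - Fintype.card V ^ 2))
    (hε0 : 0 < ε) (G : SimpleGraph (Fin n)) (hG : G.edgeSet.ncard = e) :
    (G.labelledCopyCount H : ℝ) ≤ (1 + ε) * (quasiClique n e).labelledCopyCount H := by
  classical
  have han := cliqueSize_le hn hen
  have hRa : √(2 * e) ≤ (cliqueSize e : ℝ) + 1 :=
    Real.sqrt_le_iff.2 ⟨by positivity, two_mul_le_cliqueSize_succ_sq e⟩
  set a := cliqueSize e with hadef
  set k := Fintype.card V with hk
  have ha' : (0 : ℝ) < a := by exact_mod_cast ha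
  have hcard : #G.edgeFinset = e := by rw [← hG, Set.ncard_eq_toFinset_card']; rfl
  -- The product of the sizes of these target sets is the main term of both the upper and the lower
  -- bound.
  let A : V → Finset (Fin n) := fun v =>
    if ∃ w, H.Adj v w then univ.filter fun x => (x : ℕ) < a else univ
  have hA : ∀ v, #(A v) = if ∃ w, H.Adj v w then a else n := by
    intro v
    simp only [A]
    split_ifs
    · rw [Fin.card_filter_val_lt, min_eq_right han]
    · simp
  have hup : (G.labelledCopyCount H : ℝ) ≤ (1 + 1 / (a : ℝ)) ^ k * ∏ v, (#(A v) : ℝ) := by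
    refine (H.labelledCopyCount_le_prod G (R := √(2 * e)) fun s hs hsV => ?_).trans ?_
    · rw [← hcard]
      refine G.sum_degree_pow_le hs (K := K) (le_trans (by exact_mod_cast hsV) hK) ?_
      rw [hcard, Fintype.card_fin]
      exact hdense
    · have hpow : (1 + 1 / (a : ℝ)) ^ k = ∏ _v : V, (1 + 1 / (a : ℝ)) := by simp [hk]
      rw [hpow, ← prod_mul_distrib]
      refine prod_le_prod (fun v _ => by split_ifs <;> positivity) fun v _ => ?_
      rw [hA]
      split_ifs
      · refine hRa.trans_eq ?_
        field_simp
      · rw [Fintype.card_fin]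
        exact le_mul_of_one_le_left (by positivity) (by simp)
  have hlow : (∏ v, (#(A v) : ℝ)) * a
      ≤ (quasiClique n e).labelledCopyCount H * a + k ^ 2 * ∏ v, (#(A v) : ℝ) := by
    have h1 := card_mul_le_card_injective_mul A a fun v => by
      rw [hA]; split_ifs; exacts [le_rfl, han]
    have h2 := card_injective_le_labelledCopyCount_quasiClique H n e A fun v w hvw x hx => by
      simp only [A] at hx
      rw [if_pos ⟨w, hvw⟩] at hx
      exact (mem_filter.1 hx).2
    exact_mod_cast h1.trans (Nat.add_le_add_right (Nat.mul_le_mul_right a h2) _)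
  set P : ℝ := ∏ v, (#(A v) : ℝ) with hP
  have hP0 : 0 ≤ P := prod_nonneg fun v _ => Nat.cast_nonneg _
  refine le_of_mul_le_mul_right ?_ ha'
  calc (G.labelledCopyCount H : ℝ) * a ≤ (1 + 1 / (a : ℝ)) ^ k * P * a :=
        mul_le_mul_of_nonneg_right hup ha'.le
    _ = (1 + 1 / (a : ℝ)) ^ k * a * P := by ring
    _ ≤ (1 + ε) * (a - k ^ 2) * P := mul_le_mul_of_nonneg_right hε hP0
    _ = (1 + ε) * (P * a - k ^ 2 * P) := by ring
    _ ≤ (1 + ε) * ((quasiClique n e).labelledCopyCount H * a) :=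
        mul_le_mul_of_nonneg_left (by linarith) (by linarith)
    _ = _ := by ring

theorem theorem1p2 {V : Type*} [Fintype V] (H : SimpleGraph V) :
    ∃ c : ℝ, 0 < c ∧ c < 1 ∧
      ∀ ε : ℝ, 0 < ε → ∃ n₀ : ℕ, ∀ n : ℕ, n₀ ≤ n → ∀ e : ℕ,
        c * (n.choose 2 : ℝ) ≤ (e : ℝ) → e ≤ n.choose 2 →
          |(maxCopies n e H : ℝ) - ((quasiClique n e).copyCount H : ℝ)|
            ≤ ε * ((quasiClique n e).copyCount H : ℝ) := by
  classical
  set K : ℝ := (Fintype.card V : ℝ) + 1 with hK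
  have hK1 : 1 ≤ K := by simp [hK]
  -- Half the deficit allowed by the star inequality; the other half pays for `n * (n - 1)` in place
  -- of `n ^ 2` once `n ≥ 1 / δ`.
  set δ : ℝ := 1 / (8 * K ^ 4) with hδ
  have hδ0 : 0 < δ := by positivity
  have hδ1 : δ ≤ 1 / 8 := by
    rw [hδ]
    refine one_div_le_one_div_of_le (by norm_num) ?_
    linarith [one_le_pow₀ hK1 (n := 4)]
  refine ⟨1 - δ, by linarith, by linarith, fun ε hε => ?_⟩
  obtain ⟨a₀, ha₀⟩ := exists_forall_one_add_inv_pow_mul_le (Fintype.card V) hε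
  refine ⟨max ⌈1 / δ⌉₊ (2 * a₀ + 3), fun n hn e hce hen => ?_⟩
  have hnδ : 1 / δ ≤ n := (Nat.le_ceil _).trans (by exact_mod_cast (le_max_left _ _).trans hn)
  have hna : 2 * a₀ + 3 ≤ n := (le_max_right _ _).trans hn
  have hn1 : 1 ≤ n := by omega
  have hn1' : (1 : ℝ) ≤ n := by exact_mod_cast hn1
  have hδn : 1 ≤ δ * n := by rwa [div_le_iff₀' hδ0] at hnδ
  rw [Nat.cast_choose_two] at hce
  have hdense : (1 - 1 / (4 * K ^ 4)) * (n : ℝ) ^ 2 ≤ 2 * e := by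
    have h1 : 1 / (4 * K ^ 4) = 2 * δ := by rw [hδ]; field_simp; norm_num
    have h2 : 0 ≤ n * (δ * n - 1) := mul_nonneg (by positivity) (by linarith)
    rw [h1]
    linarith
  -- Density gives `(a + 1) ^ 2 ≥ 2e ≥ ((n - 1) / 2) ^ 2`, so `a ≥ (n - 3) / 2`; hence the threshold
  -- `2 * a₀ + 3`.
  have ha : a₀ ≤ cliqueSize e := by
    have h1 : ((n - 1 : ℝ) / 2) ^ 2 ≤ ((cliqueSize e : ℝ) + 1) ^ 2 := by
      refine le_trans ?_ (two_mul_le_cliqueSize_succ_sq e)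
      have h2 : 0 ≤ (7 / 8 - δ) * (n * (n - 1 : ℝ)) :=
        mul_nonneg (by linarith) (mul_nonneg (by positivity) (by linarith))
      nlinarith
    have h3 := (pow_le_pow_iff_left₀ (by linarith) (by positivity) two_ne_zero).1 h1
    have h4 : (2 * a₀ + 3 : ℝ) ≤ n := by exact_mod_cast hna
    have h5 : (a₀ : ℝ) ≤ cliqueSize e := by linarith
    exact_mod_cast h5
  obtain ⟨ha0, haε⟩ := ha₀ _ ha
  have hQ := ncard_edgeSet_quasiClique hn1 hen
  have hmem : quasiClique n e ∈
      (univ : Finset (SimpleGraph (Fin n))).filter fun G => G.edgeSet.ncard = e := by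
    simpa using hQ
  have hlow : (quasiClique n e).copyCount H ≤ maxCopies n e H := by
    rw [maxCopies]
    convert! le_sup (f := fun G : SimpleGraph (Fin n) => G.copyCount H) hmem
  have hup : (maxCopies n e H : ℝ) ≤ (1 + ε) * (quasiClique n e).copyCount H := by
    obtain ⟨G, hG, hGmax⟩ := exists_mem_eq_sup _ ⟨_, hmem⟩
      fun G : SimpleGraph (Fin n) => G.copyCount H
    have h1 : maxCopies n e H = G.copyCount H := by
      rw [maxCopies, ← hGmax]
    have h2 := labelledCopyCount_le_quasiClique H hn1 hen (K := K) (by linarith) hdense ha0 haε hε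
      G (mem_filter.1 hG).2
    rw [H.labelledCopyCount_eq_copyCount_mul, H.labelledCopyCount_eq_copyCount_mul] at h2
    push_cast at h2
    have hpos : (0 : ℝ) < Nat.card (H ≃g H) := by
      have : Nonempty (H ≃g H) := ⟨SimpleGraph.Iso.refl⟩
      have : Finite (H ≃g H) := DFunLike.finite _
      exact_mod_cast Nat.card_pos
    rw [h1]
    refine le_of_mul_le_mul_right ?_ hpos
    linarith
  have hlow' : ((quasiClique n e).copyCount H : ℝ) ≤ maxCopies n e H := by exact_mod_cast hlow
  rw [abs_of_nonneg (by linarith)]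
  linarith
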